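/- Let $k$ be a field of characteristic $p\ge 3$, let $N\ge 1$ be an integer, and suppose that $\#k\ge 4^{2N-1}+2$ ($k$ may be infinite). For $n\ge 1$ let $\mathrm{GA}_n(k)=\mathrm{Aut}_k\,k[x_1,\dots,x_n]$, whose elements $\phi$ are written as tuples $(\phi(x_1),\dots,\phi(x_n))$, with composition $(\phi\circ\psi)(f)=\phi(\psi(f))$. Regard $\mathrm{GA}_n(k)$ as a subgroup of $\mathrm{GA}_{n+1}(k)$ by extending $\phi$ by $\phi(x_{n+1})=x_{n+1}$. Let $\mathrm{Aff}_n(k)$ be the group of affine automorphisms $(x_1,\dots,x_n)A+b$ with $A\in \mathrm{GL}_n(k)$, $b\in k^n$, and let the tame subgroup $\mathrm{T}_n(k)$ be the subgroup of $\mathrm{GA}_n(k)$ generated by $\mathrm{Aff}_n(k)$ and all $(x_1+f,x_2,\dots,x_n)$ with $f\in k[x_2,\dots,x_n]$. An element $\phi\in\mathrm{GA}_n(k)$ is called stably co-tame if the subgroup $\langle \mathrm{Aff}_{n+1}(k),\phi\rangle$ of $\mathrm{GA}_{n+1}(k)$ contains $\mathrm{T}_n(k)$. Let $\beta=(x_1+x_2^2(x_2+x_3^2)^2,\;x_2+x_3^2,\;x_3)$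 and $\pi=(x_2,x_1,x_3)$ in $\mathrm{GA}_3(k)$. Then the automorphism $$\theta_N=(\beta\circ\pi)^{-N}\circ\pi\circ(\beta\circ\pi)^N\in\mathrm{GA}_3(k)$$ is stably co-tame. -/

import Mathlib

open MvPolynomial

noncomputable section

namespace PolyAut

/-- The group of automorphisms of the `R`-algebra `R[x_1, ..., x_n]`.  The variable `x_i` is
`X (i - 1)`.  The multiplication is composition of maps, `(φ * ψ) f = φ (ψ f)`; in terms of
tuples `φ = (f_1, ..., f_n)`, `ψ = (g_1, ..., g_n)` this is
`φ * ψ = (g_1 (f_1, ..., f_n), ..., g_n (f_1, ..., f_n))`. -/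
abbrev GA (n : ℕ) (R : Type*) [CommRing R] : Type _ :=
  MvPolynomial (Fin n) R ≃ₐ[R] MvPolynomial (Fin n) R

/-- `φ = (x_1, ..., x_n) A + b` for some `A ∈ GL_n(R)` and `b ∈ R^n`. -/
def IsAffine {n : ℕ} {R : Type*} [CommRing R] (φ : GA n R) : Prop :=
  ∃ (A : Matrix.GeneralLinearGroup (Fin n) R) (b : Fin n → R),
    ∀ i, φ (X i) = (∑ j, X j * C ((A : Matrix (Fin n) (Fin n) R) j i)) + C (b i)

/-- The set of affine automorphisms. -/
def Aff (n : ℕ) (R : Type*) [CommRing R] : Set (GA n R) := {φ | IsAffine φ}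

/-- The substitution `(x_1 + f, x_2, ..., x_n)`. -/
def epsHom {n : ℕ} [NeZero n] {R : Type*} [CommRing R] (f : MvPolynomial (Fin n) R) :
    MvPolynomial (Fin n) R →ₐ[R] MvPolynomial (Fin n) R :=
  aeval fun i => if i = 0 then X i + f else X i

theorem epsHom_of_mem {n : ℕ} [NeZero n] {R : Type*} [CommRing R]
    (f g : MvPolynomial (Fin n) R) (hg : g ∈ supported R {i : Fin n | i ≠ 0}) :
    epsHom f g = g := by
  have h : epsHom f g = AlgHom.id R (MvPolynomial (Fin n) R) g := by
    refine MvPolynomial.hom_congr_vars (f₁ := (epsHom f).toRingHom)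
      (f₂ := (AlgHom.id R (MvPolynomial (Fin n) R)).toRingHom) ?_ ?_ rfl
    · ext r
      simp [epsHom]
    · intro i hi _
      have h0 : i ≠ 0 := (mem_supported.mp hg) hi
      simp [epsHom, h0]
  simpa using h

theorem epsHom_comp_neg {n : ℕ} [NeZero n] {R : Type*} [CommRing R]
    (f : MvPolynomial (Fin n) R) (hf : f ∈ supported R {i : Fin n | i ≠ 0}) :
    (epsHom f).comp (epsHom (-f)) = AlgHom.id R _ := by
  refine MvPolynomial.algHom_ext fun i => ?_
  by_cases hi : i = 0
  · have h1 : epsHom (-f) (X i) = X i + -f := by simp [epsHom, hi]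
    have h2 : epsHom f (X i) = X i + f := by simp [epsHom, hi]
    rw [AlgHom.comp_apply, h1, map_add, map_neg, epsHom_of_mem f f hf, h2]
    simp
  · simp [epsHom, hi]

/-- The elementary automorphism `ε(f) = (x_1 + f, x_2, ..., x_n)` for `f ∈ R[x_2, ..., x_n]`. -/
def eps {n : ℕ} [NeZero n] {R : Type*} [CommRing R]
    (f : supported R {i : Fin n | i ≠ 0}) : GA n R :=
  AlgEquiv.ofAlgHom (epsHom (f : MvPolynomial (Fin n) R)) (epsHom (-(f : MvPolynomial (Fin n) R)))
    (epsHom_comp_neg _ f.2)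
    (by simpa using epsHom_comp_neg (-(f : MvPolynomial (Fin n) R)) (neg_mem f.2))

/-- The set of all `ε(f)` with `f ∈ R[x_2, ..., x_n]`. -/
def E (n : ℕ) [NeZero n] (R : Type*) [CommRing R] : Set (GA n R) := Set.range eps

/-- The tame subgroup. -/
def Tame (n : ℕ) [NeZero n] (R : Type*) [CommRing R] : Subgroup (GA n R) :=
  Subgroup.closure (Aff n R ∪ E n R)

/-- The endomorphism of `R[x_1, ..., x_{n+1}]` that agrees with `φ` on `R[x_1, ..., x_n]` and
fixes `x_{n+1}`. -/
def extendHom {n : ℕ} {R : Type*} [CommRing R]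
    (φ : MvPolynomial (Fin n) R →ₐ[R] MvPolynomial (Fin n) R) :
    MvPolynomial (Fin (n + 1)) R →ₐ[R] MvPolynomial (Fin (n + 1)) R :=
  aeval (Fin.lastCases (X (Fin.last n)) fun i => rename Fin.castSucc (φ (X i)))

theorem extendHom_last {n : ℕ} {R : Type*} [CommRing R]
    (φ : MvPolynomial (Fin n) R →ₐ[R] MvPolynomial (Fin n) R) :
    extendHom φ (X (Fin.last n)) = X (Fin.last n) := by
  simp [extendHom]

theorem extendHom_rename {n : ℕ} {R : Type*} [CommRing R]
    (φ : MvPolynomial (Fin n) R →ₐ[R] MvPolynomial (Fin n) R) (f : MvPolynomial (Fin n) R) :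
    extendHom φ (rename Fin.castSucc f) = rename Fin.castSucc (φ f) := by
  have h : (extendHom φ).comp (rename Fin.castSucc) = (rename Fin.castSucc).comp φ :=
    MvPolynomial.algHom_ext fun i => by simp [extendHom]
  exact DFunLike.congr_fun h f

theorem extendHom_comp {n : ℕ} {R : Type*} [CommRing R]
    (φ ψ : MvPolynomial (Fin n) R →ₐ[R] MvPolynomial (Fin n) R) :
    (extendHom φ).comp (extendHom ψ) = extendHom (φ.comp ψ) := by
  refine MvPolynomial.algHom_ext fun i => ?_
  refine Fin.lastCases ?_ (fun i => ?_) i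
  · simp [extendHom_last]
  · have h := fun χ : MvPolynomial (Fin n) R →ₐ[R] MvPolynomial (Fin n) R =>
      extendHom_rename χ (X i)
    simp only [rename_X] at h
    simp [h, extendHom_rename]

theorem extendHom_id {n : ℕ} {R : Type*} [CommRing R] :
    extendHom (AlgHom.id R (MvPolynomial (Fin n) R)) = AlgHom.id R _ := by
  refine MvPolynomial.algHom_ext fun i => ?_
  refine Fin.lastCases ?_ (fun i => ?_) i <;> simp [extendHom]

/-- The extension of an automorphism `φ` of `R[x_1, ..., x_n]` to the unique automorphism of
`R[x_1, ..., x_{n+1}]` that agrees with `φ` on `R[x_1, ..., x_n]` and fixes `x_{n+1}`. -/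
def extendEquiv {n : ℕ} {R : Type*} [CommRing R] (φ : GA n R) : GA (n + 1) R :=
  AlgEquiv.ofAlgHom (extendHom φ.toAlgHom) (extendHom φ.symm.toAlgHom)
    (by
      have h : φ.toAlgHom.comp φ.symm.toAlgHom = AlgHom.id R _ := AlgEquiv.comp_symm φ
      rw [extendHom_comp, h, extendHom_id])
    (by
      have h : φ.symm.toAlgHom.comp φ.toAlgHom = AlgHom.id R _ := AlgEquiv.symm_comp φ
      rw [extendHom_comp, h, extendHom_id])

theorem extendEquiv_apply {n : ℕ} {R : Type*} [CommRing R] (φ : GA n R)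
    (f : MvPolynomial (Fin (n + 1)) R) : extendEquiv φ f = extendHom φ.toAlgHom f := rfl

/-- The embedding of the automorphism group in `n` variables into the one in `n + 1` variables. -/
def extend (n : ℕ) (R : Type*) [CommRing R] : GA n R →* GA (n + 1) R where
  toFun := extendEquiv
  map_one' := by
    refine AlgEquiv.ext fun f => ?_
    have h : (1 : GA n R).toAlgHom = AlgHom.id R _ := AlgHom.ext fun _ => rfl
    rw [extendEquiv_apply, h, extendHom_id]
    rfl
  map_mul' φ ψ := by
    refine AlgEquiv.ext fun f => ?_
    have h : (φ * ψ).toAlgHom = φ.toAlgHom.comp ψ.toAlgHom := AlgHom.ext fun _ => rfl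
    rw [AlgEquiv.mul_apply, extendEquiv_apply, extendEquiv_apply, extendEquiv_apply, h,
      ← extendHom_comp, AlgHom.comp_apply]

/-- `φ` is stably co-tame: the subgroup generated by the affine automorphisms in `n + 1`
variables and `φ` contains the tame subgroup in `n` variables. -/
def IsStablyCoTame {n : ℕ} [NeZero n] {R : Type*} [CommRing R] (φ : GA n R) : Prop :=
  (Tame n R).map (extend n R) ≤ Subgroup.closure (Aff (n + 1) R ∪ {extend n R φ})

/-- `β = (x_1 + x_2^2 (x_2 + x_3^2)^2, x_2 + x_3^2, x_3)`. -/
def beta (R : Type*) [CommRing R] : GA 3 R :=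
  AlgEquiv.ofAlgHom
    (aeval ![X 0 + X 1 ^ 2 * (X 1 + X 2 ^ 2) ^ 2, X 1 + X 2 ^ 2, X 2])
    (aeval ![X 0 - (X 1 - X 2 ^ 2) ^ 2 * X 1 ^ 2, X 1 - X 2 ^ 2, X 2])
    (by
      refine MvPolynomial.algHom_ext fun i => ?_
      fin_cases i <;> simp)
    (by
      refine MvPolynomial.algHom_ext fun i => ?_
      fin_cases i <;> simp)

/-- `π = (x_2, x_1, x_3)`. -/
def pi (R : Type*) [CommRing R] : GA 3 R :=
  AlgEquiv.ofAlgHom (aeval ![X 1, X 0, X 2]) (aeval ![X 1, X 0, X 2])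
    (by
      refine MvPolynomial.algHom_ext fun i => ?_
      fin_cases i <;> simp)
    (by
      refine MvPolynomial.algHom_ext fun i => ?_
      fin_cases i <;> simp)

/-- `θ_N = (β ∘ π)^{-N} ∘ π ∘ (β ∘ π)^N`. -/
def theta (R : Type*) [CommRing R] (N : ℕ) : GA 3 R :=
  (beta R * pi R) ^ (-(N : ℤ)) * pi R * (beta R * pi R) ^ N

end PolyAut

end

/-! Let `G` be the group generated by the affine automorphisms in one extra variable and an
automorphism `φ`. The polynomials `f` with `(x_1, ..., x_n, x_{n+1} + f)` in `G` form a space `M`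
(`shearSubmodule`). It is a `k`-subspace, because rescaling `x_{n+1}` rescales `f`. It contains the
affine forms and is stable under every automorphism whose extension lies in `G`, because conjugation
carries the shear by `f` to the shear by its image.

One square `x_i^2` in `M` is enough when 2 is invertible. Permutations and polarization give `x_1
x_j`. If `g` in `k[x_2, ..., x_n]` lies in `M`, then `ε(g)` lies in `G`, and applying it to `x_1
x_j` shows that `g x_j` lies in `M`. So `M` contains `k[x_2, ..., x_n]`, and `G` contains every
`ε(f)` (`map_tame_le`).

For `θ_N`, the polynomial `θ_N(x_1)` lies in `M`. Scaling `x_1` by enough distinct units and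
inverting a Vandermonde matrix puts each of its `x_1`-homogeneous components in `M`
(`component_mem`). Iterating the Hénon-like map `β ∘ π` keeps the second coefficient in `x_1` a
nonzero multiple of `x_3^2` (`theta_X_zero`). Hence `x_3^2 x_1^d` lies in `M`, and translating `x_1`
and taking the constant component gives `x_3^2` (`X_two_sq_mem`). -/

noncomputable section

namespace PolyAut

/-! ### Affine automorphisms -/

section Affine

variable {n : ℕ} {R : Type*} [CommRing R]

/-- The polynomials of degree at most one. -/
def affineForms (n : ℕ) (R : Type*) [CommRing R] : Submodule R (MvPolynomial (Fin n) R) :=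
  Submodule.span R (insert 1 (Set.range X))

theorem X_mem_affineForms (i : Fin n) : (X i : MvPolynomial (Fin n) R) ∈ affineForms n R :=
  Submodule.subset_span (Or.inr ⟨i, rfl⟩)

theorem C_mem_affineForms (r : R) : (C r : MvPolynomial (Fin n) R) ∈ affineForms n R := by
  rw [← mul_one (C r), ← smul_eq_C_mul]
  exact Submodule.smul_mem _ _ (Submodule.subset_span (Or.inl rfl))

theorem X_mul_C_mem_affineForms (i : Fin n) (r : R) :
    (X i * C r : MvPolynomial (Fin n) R) ∈ affineForms n R := by
  rw [mul_comm, ← smul_eq_C_mul]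
  exact Submodule.smul_mem _ _ (X_mem_affineForms i)

theorem mem_affineForms_iff {f : MvPolynomial (Fin n) R} :
    f ∈ affineForms n R ↔ ∃ (a : Fin n → R) (b : R), f = ∑ j, X j * C (a j) + C b := by
  constructor
  · intro hf
    induction hf using Submodule.span_induction with
    | mem f hf =>
      rcases hf with rfl | ⟨i, rfl⟩
      · exact ⟨0, 1, by simp⟩
      · refine ⟨Pi.single i 1, 0, ?_⟩
        rw [Finset.sum_eq_single i]
        · simp
        · intro j _ hj
          simp [hj]
        · simp
    | zero => exact ⟨0, 0, by simp⟩
    | add f g _ _ hf hg =>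
      obtain ⟨a, b, rfl⟩ := hf
      obtain ⟨a', b', rfl⟩ := hg
      refine ⟨a + a', b + b', ?_⟩
      simp only [Pi.add_apply, map_add, mul_add, Finset.sum_add_distrib]
      ring
    | smul r f _ hf =>
      obtain ⟨a, b, rfl⟩ := hf
      refine ⟨r • a, r * b, ?_⟩
      simp only [smul_add, Finset.smul_sum, Pi.smul_apply, smul_eq_mul, smul_eq_C_mul, map_mul]
      congr 1
      exact Finset.sum_congr rfl fun j _ => by ring
  · rintro ⟨a, b, rfl⟩
    exact add_mem (sum_mem fun j _ => X_mul_C_mem_affineForms j _) (C_mem_affineForms b)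

theorem pderiv_affineForm (l : Fin n) (a : Fin n → R) (b : R) :
    pderiv l (∑ j, X j * C (a j) + C b) = C (a l) := by
  simp only [map_add, map_sum, Derivation.leibniz, pderiv_C, pderiv_X, smul_zero, add_zero,
    zero_add]
  rw [Finset.sum_eq_single l]
  · simp
  · intro j _ hj
    simp [hj]
  · simp

/-- This replaces the invertible matrix by degree conditions that can be checked on generators: the
inverse matrix is read off from the inverse automorphism. -/
theorem isAffine_iff {φ : GA n R} :
    IsAffine φ ↔ (∀ i, φ (X i) ∈ affineForms n R) ∧ ∀ i, φ⁻¹ (X i) ∈ affineForms n R := by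
  constructor
  · rintro ⟨A, b, h⟩
    refine ⟨fun i => mem_affineForms_iff.mpr ⟨_, _, h i⟩, fun l => ?_⟩
    let B : Matrix (Fin n) (Fin n) R := ↑A⁻¹
    have hAB : (A : Matrix (Fin n) (Fin n) R) * B = 1 := by simp [B]
    have key : φ (∑ i, X i * C (B i l) + C (-∑ i, b i * B i l)) = X l := by
      have h1 : ∀ r : R, φ (C r) = C r := fun r => φ.commutes r
      simp only [map_add, map_sum, map_mul, h, h1, add_mul, Finset.sum_add_distrib, map_neg,
        Finset.sum_mul]
      rw [Finset.sum_comm, add_neg_cancel_right]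
      have h2 : ∀ j, ∑ i, X j * C ((A : Matrix (Fin n) (Fin n) R) j i) * C (B i l)
          = X j * C ((1 : Matrix (Fin n) (Fin n) R) j l) := by
        intro j
        rw [← hAB, Matrix.mul_apply, map_sum, Finset.mul_sum]
        exact Finset.sum_congr rfl fun i _ => by rw [map_mul, mul_assoc]
      simp only [h2, Matrix.one_apply]
      rw [Finset.sum_eq_single l]
      · simp
      · intro j _ hj
        simp [hj]
      · simp
    have : φ⁻¹ (X l) = ∑ i, X i * C (B i l) + C (-∑ i, b i * B i l) := by
      rw [← key]
      exact φ.symm_apply_apply _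
    rw [this]
    exact mem_affineForms_iff.mpr ⟨_, _, rfl⟩
  · rintro ⟨h, h'⟩
    simp only [mem_affineForms_iff] at h h'
    choose a b hab using h
    choose a' b' hab' using h'
    have key : ∀ {ψ χ : GA n R} {c d : Fin n → Fin n → R} {e f : Fin n → R},
        (∀ i, ψ (X i) = ∑ j, X j * C (c i j) + C (e i)) →
        (∀ i, χ (X i) = ∑ j, X j * C (d i j) + C (f i)) → ψ * χ = 1 →
        (Matrix.of fun j i => c i j) * (Matrix.of fun j i => d i j) = 1 := by
      intro ψ χ c d e f hψ hχ hmul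
      ext l i
      have h1 : ψ (χ (X i)) = X i := DFunLike.congr_fun hmul (X i)
      have h2 : ∀ r : R, ψ (C r) = C r := fun r => ψ.commutes r
      rw [hχ] at h1
      simp only [map_add, map_sum, map_mul, hψ, h2] at h1
      -- Differentiating in `x_l` isolates the linear coefficients, so the composition identity
      -- becomes a matrix identity.
      have h3 := congrArg (pderiv l) h1
      have h4 : ∀ g : MvPolynomial (Fin n) R, ∀ r : R, pderiv l (g * C r) = pderiv l g * C r := by
        intro g r
        simp [Derivation.leibniz, mul_comm]
      rw [map_add, map_sum, pderiv_C, add_zero] at h3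
      simp only [h4, pderiv_affineForm] at h3
      have h5 : (C (∑ x, c x l * d i x) : MvPolynomial (Fin n) R)
          = C ((1 : Matrix (Fin n) (Fin n) R) l i) := by
        rw [map_sum]
        simp only [map_mul, h3, pderiv_X, Matrix.one_apply, Pi.single_apply]
        by_cases hli : l = i
        · simp [hli]
        · simp [hli, Ne.symm hli]
      rw [Matrix.mul_apply]
      exact C_injective _ _ h5
    exact ⟨⟨Matrix.of fun j i => a i j, Matrix.of fun j i => a' i j,
      key hab hab' (mul_inv_cancel φ), key hab' hab (inv_mul_cancel φ)⟩, b, hab⟩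

theorem isAffine_ofAlgHom {f g : MvPolynomial (Fin n) R →ₐ[R] MvPolynomial (Fin n) R}
    (h₁ : f.comp g = AlgHom.id R _) (h₂ : g.comp f = AlgHom.id R _)
    (hf : ∀ i, f (X i) ∈ affineForms n R) (hg : ∀ i, g (X i) ∈ affineForms n R) :
    IsAffine (AlgEquiv.ofAlgHom f g h₁ h₂) :=
  isAffine_iff.mpr ⟨hf, hg⟩

theorem rename_mem_affineForms {m : ℕ} (e : Fin n → Fin m) {f : MvPolynomial (Fin n) R}
    (hf : f ∈ affineForms n R) : rename e f ∈ affineForms m R := by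
  obtain ⟨a, b, rfl⟩ := mem_affineForms_iff.mp hf
  simp only [map_add, map_sum, map_mul, rename_X, rename_C]
  exact add_mem (sum_mem fun j _ => X_mul_C_mem_affineForms _ _) (C_mem_affineForms _)

theorem isAffine_renameEquiv (e : Equiv.Perm (Fin n)) : IsAffine (renameEquiv R e) := by
  refine isAffine_iff.mpr ⟨fun i => ?_, fun i => ?_⟩
  · simpa using X_mem_affineForms _
  · change (renameEquiv R e).symm (X i) ∈ _
    simpa using X_mem_affineForms _

/-- The automorphism `x_i ↦ c x_i` for a unit `c`. -/
def scale (i : Fin n) (c : Rˣ) : GA n R :=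
  AlgEquiv.ofAlgHom (aeval (Function.update X i (C (c : R) * X i)))
    (aeval (Function.update X i (C ((c⁻¹ : Rˣ) : R) * X i)))
    (by
      refine MvPolynomial.algHom_ext fun j => ?_
      by_cases hj : j = i
      · subst hj
        simp [algebraMap_eq, ← mul_assoc, ← C_mul]
      · simp [hj])
    (by
      refine MvPolynomial.algHom_ext fun j => ?_
      by_cases hj : j = i
      · subst hj
        simp [algebraMap_eq, ← mul_assoc, ← C_mul]
      · simp [hj])

theorem scale_X (i j : Fin n) (c : Rˣ) :
    scale i c (X j) = if j = i then C (c : R) * X i else X j := by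
  change aeval (Function.update X i (C (c : R) * X i)) (X j) = _
  rw [aeval_X, Function.update_apply]

theorem isAffine_scale (i : Fin n) (c : Rˣ) : IsAffine (scale i c) := by
  have h : ∀ (r : R) j, aeval (R := R) (Function.update X i (C r * X i)) (X j) ∈
      affineForms n R := by
    intro r j
    rw [aeval_X, Function.update_apply, mul_comm]
    split_ifs
    · exact X_mul_C_mem_affineForms _ _
    · exact X_mem_affineForms _
  exact isAffine_ofAlgHom _ _ (h _) (h _)

theorem isAffine_eps [NeZero n] (f : supported R {i : Fin n | i ≠ 0})
    (hf : (f : MvPolynomial (Fin n) R) ∈ affineForms n R) : IsAffine (eps f) := by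
  have h : ∀ g ∈ affineForms n R, ∀ i, epsHom g (X i) ∈ affineForms n R := by
    intro g hg i
    rw [epsHom, aeval_X]
    split_ifs
    · exact add_mem (X_mem_affineForms _) hg
    · exact X_mem_affineForms _
  exact isAffine_ofAlgHom _ _ (h _ hf) (h _ (neg_mem hf))

theorem eps_X [NeZero n] (f : supported R {i : Fin n | i ≠ 0}) (j : Fin n) :
    eps f (X j) = if j = 0 then X j + (f : MvPolynomial (Fin n) R) else X j := by
  change epsHom _ (X j) = _
  rw [epsHom, aeval_X]

theorem extend_X_castSucc (φ : GA n R) (i : Fin n) :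
    extend n R φ (X i.castSucc) = rename Fin.castSucc (φ (X i)) := by
  have h := extendHom_rename φ.toAlgHom (X i)
  rw [rename_X] at h
  exact h

theorem extend_rename (φ : GA n R) (f : MvPolynomial (Fin n) R) :
    extend n R φ (rename Fin.castSucc f) = rename Fin.castSucc (φ f) :=
  extendHom_rename φ.toAlgHom f

theorem extend_X_last (φ : GA n R) : extend n R φ (X (Fin.last n)) = X (Fin.last n) :=
  extendHom_last φ.toAlgHom

theorem isAffine_extend {φ : GA n R} (hφ : IsAffine φ) : IsAffine (extend n R φ) := by
  have key : ∀ ψ : GA n R, (∀ i, ψ (X i) ∈ affineForms n R) →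
      ∀ i, extend n R ψ (X i) ∈ affineForms (n + 1) R := by
    intro ψ hψ i
    refine Fin.lastCases ?_ (fun i => ?_) i
    · rw [extend_X_last]
      exact X_mem_affineForms _
    · rw [extend_X_castSucc]
      exact rename_mem_affineForms _ (hψ i)
  rw [isAffine_iff] at hφ ⊢
  refine ⟨key φ hφ.1, ?_⟩
  rw [← map_inv]
  exact key _ hφ.2

end Affine

/-! ### Shears in the last variable and their conjugates -/

section Shear

variable {n : ℕ} {R : Type*} [CommRing R]

/-- The substitution `(x_1, ..., x_n, x_{n+1} + f)`. -/
def shearHom (f : MvPolynomial (Fin n) R) :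
    MvPolynomial (Fin (n + 1)) R →ₐ[R] MvPolynomial (Fin (n + 1)) R :=
  aeval (Fin.lastCases (X (Fin.last n) + rename Fin.castSucc f) fun i => X i.castSucc)

theorem shearHom_X_last (f : MvPolynomial (Fin n) R) :
    shearHom f (X (Fin.last n)) = X (Fin.last n) + rename Fin.castSucc f := by
  simp [shearHom]

theorem shearHom_X_castSucc (f : MvPolynomial (Fin n) R) (i : Fin n) :
    shearHom f (X i.castSucc) = X i.castSucc := by
  simp [shearHom]

theorem shearHom_rename (f g : MvPolynomial (Fin n) R) :
    shearHom f (rename Fin.castSucc g) = rename Fin.castSucc g := by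
  have h : (shearHom f).comp (rename Fin.castSucc) = rename Fin.castSucc :=
    MvPolynomial.algHom_ext fun i => by simp [shearHom_X_castSucc]
  exact DFunLike.congr_fun h g

theorem shearHom_comp (f g : MvPolynomial (Fin n) R) :
    (shearHom f).comp (shearHom g) = shearHom (f + g) := by
  refine MvPolynomial.algHom_ext fun i => ?_
  refine Fin.lastCases ?_ (fun i => ?_) i
  · simp [shearHom_X_last, shearHom_rename, add_assoc]
  · simp [shearHom_X_castSucc]

theorem shearHom_zero : shearHom (0 : MvPolynomial (Fin n) R) = AlgHom.id R _ := by
  refine MvPolynomial.algHom_ext fun i => ?_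
  refine Fin.lastCases ?_ (fun i => ?_) i
  · simp [shearHom_X_last]
  · simp [shearHom_X_castSucc]

/-- The automorphism `(x_1, ..., x_n, x_{n+1} + f)` for `f ∈ R[x_1, ..., x_n]`. -/
def shear (f : MvPolynomial (Fin n) R) : GA (n + 1) R :=
  AlgEquiv.ofAlgHom (shearHom f) (shearHom (-f))
    (by rw [shearHom_comp, add_neg_cancel, shearHom_zero])
    (by rw [shearHom_comp, neg_add_cancel, shearHom_zero])

theorem shear_X_last (f : MvPolynomial (Fin n) R) :
    shear f (X (Fin.last n)) = X (Fin.last n) + rename Fin.castSucc f := shearHom_X_last f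

theorem shear_X_castSucc (f : MvPolynomial (Fin n) R) (i : Fin n) :
    shear f (X i.castSucc) = X i.castSucc := shearHom_X_castSucc f i

theorem shear_rename (f g : MvPolynomial (Fin n) R) :
    shear f (rename Fin.castSucc g) = rename Fin.castSucc g := shearHom_rename f g

theorem GA_ext {φ ψ : GA n R} (h : ∀ i, φ (X i) = ψ (X i)) : φ = ψ :=
  AlgEquiv.coe_toAlgHom_injective (MvPolynomial.algHom_ext h)

theorem shear_add (f g : MvPolynomial (Fin n) R) : shear (f + g) = shear f * shear g :=
  AlgEquiv.ext fun x => (DFunLike.congr_fun (shearHom_comp f g) x).symm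

theorem shear_zero : shear (0 : MvPolynomial (Fin n) R) = 1 :=
  AlgEquiv.ext fun x => DFunLike.congr_fun shearHom_zero x

theorem isAffine_shear {f : MvPolynomial (Fin n) R} (hf : f ∈ affineForms n R) :
    IsAffine (shear f) := by
  have h : ∀ g ∈ affineForms n R, ∀ i, shearHom g (X i) ∈ affineForms (n + 1) R := by
    intro g hg i
    refine Fin.lastCases ?_ (fun i => ?_) i
    · rw [shearHom_X_last]
      exact add_mem (X_mem_affineForms _) (rename_mem_affineForms _ hg)
    · rw [shearHom_X_castSucc]
      exact X_mem_affineForms _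
  exact isAffine_ofAlgHom _ _ (h _ hf) (h _ (neg_mem hf))

/-- This conjugation rule is what makes the space of admissible `f` stable under `φ`. -/
theorem extend_mul_shear (φ : GA n R) (f : MvPolynomial (Fin n) R) :
    extend n R φ * shear f = shear (φ f) * extend n R φ := by
  refine GA_ext fun i => ?_
  refine Fin.lastCases ?_ (fun i => ?_) i
  · simp only [AlgEquiv.mul_apply, shear_X_last, extend_X_last, map_add, extend_rename]
  · simp only [AlgEquiv.mul_apply, shear_X_castSucc, extend_X_castSucc, shear_rename]

theorem scale_mul_shear (c : Rˣ) (f : MvPolynomial (Fin n) R) :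
    scale (Fin.last n) c * shear ((c : R) • f) = shear f * scale (Fin.last n) c := by
  have h : ∀ g : MvPolynomial (Fin n) R,
      scale (Fin.last n) c (rename Fin.castSucc g) = rename Fin.castSucc g := by
    intro g
    have h : (scale (Fin.last n) c : GA (n + 1) R).toAlgHom.comp (rename Fin.castSucc)
        = rename Fin.castSucc :=
      MvPolynomial.algHom_ext fun i => by
        rw [AlgHom.comp_apply, rename_X]
        exact (scale_X _ _ _).trans (if_neg (Fin.castSucc_lt_last i).ne)
    exact DFunLike.congr_fun h g
  have hC : ∀ r : R, shear f (C r) = C r := fun r => (shear f).commutes r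
  have hC' : ∀ r : R, scale (Fin.last n) c (C r) = C r := fun r => AlgEquiv.commutes _ r
  refine GA_ext fun i => ?_
  refine Fin.lastCases ?_ (fun i => ?_) i
  · simp only [AlgEquiv.mul_apply, shear_X_last, map_add, h, scale_X, if_true, map_mul, hC,
      rename_C, smul_eq_C_mul, mul_add,
      hC']
  · simp only [AlgEquiv.mul_apply, shear_X_castSucc, scale_X, (Fin.castSucc_lt_last i).ne,
      if_false]

/-- Exchanging `x_1` and `x_{n+1}` leaves `f` alone, since `f` does not involve `x_1`. Thus
elementary automorphisms reduce to shears. -/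
theorem extend_eps_eq [NeZero n] (f : supported R {i : Fin n | i ≠ 0}) :
    extend n R (eps f) = renameEquiv R (Equiv.swap (Fin.castSucc (0 : Fin n)) (Fin.last n)) *
      shear (f : MvPolynomial (Fin n) R) *
      renameEquiv R (Equiv.swap (Fin.castSucc (0 : Fin n)) (Fin.last n)) := by
  have hf : rename (Equiv.swap (Fin.castSucc (0 : Fin n)) (Fin.last n) ∘ Fin.castSucc)
      (f : MvPolynomial (Fin n) R) = rename Fin.castSucc (f : MvPolynomial (Fin n) R) := by
    refine MvPolynomial.hom_congr_vars (f₁ := (rename _).toRingHom)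
      (f₂ := (rename _).toRingHom) ?_ ?_ rfl
    · ext r
      simp
    · intro i hi _
      have h0 : i ≠ 0 := (mem_supported.mp f.2) hi
      have h1 : i.castSucc ≠ Fin.castSucc (0 : Fin n) := fun h => h0 (Fin.castSucc_injective n h)
      simp [-Fin.castSucc_zero', -Fin.castSucc_zero,
        Equiv.swap_apply_of_ne_of_ne h1 (Fin.castSucc_lt_last i).ne]
  refine GA_ext fun i => ?_
  refine Fin.lastCases ?_ (fun i => ?_) i
  · simp [-Fin.castSucc_zero', -Fin.castSucc_zero, AlgEquiv.mul_apply, extend_X_last,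
      shear_X_castSucc]
  · rw [extend_X_castSucc, eps_X]
    by_cases hi : i = 0
    · subst hi
      simp [-Fin.castSucc_zero', -Fin.castSucc_zero, AlgEquiv.mul_apply, shear_X_last,
        rename_rename, hf]
    · have h1 : i.castSucc ≠ Fin.castSucc (0 : Fin n) := fun h => hi (Fin.castSucc_injective n h)
      simp [-Fin.castSucc_zero', -Fin.castSucc_zero, AlgEquiv.mul_apply, shear_X_castSucc, hi,
        Equiv.swap_apply_of_ne_of_ne h1 (Fin.castSucc_lt_last i).ne]

end Shear

/-! ### Vandermonde extraction -/

/-- If a submodule contains `∑ c ^ j v_j` for enough distinct scalars `c`, it contains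
every `v_j`. -/
theorem mem_of_sum_pow_smul_mem {k V : Type*} [Field k] [AddCommGroup V] [Module k V]
    (M : Submodule k V) {m : ℕ} {c : Fin m → k} (hc : Function.Injective c) (v : Fin m → V)
    (h : ∀ i, ∑ j : Fin m, c i ^ (j : ℕ) • v j ∈ M) (j : Fin m) : v j ∈ M := by
  have hW : (Matrix.vandermonde c)⁻¹ * Matrix.vandermonde c = 1 :=
    Matrix.nonsing_inv_mul _ (isUnit_iff_ne_zero.mpr (Matrix.det_vandermonde_ne_zero_iff.mpr hc))
  have hv : v j = ∑ i, (Matrix.vandermonde c)⁻¹ j i • ∑ l : Fin m, c i ^ (l : ℕ) • v l := by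
    simp only [Finset.smul_sum, smul_smul]
    rw [Finset.sum_comm]
    simp only [← Finset.sum_smul]
    have h1 : ∀ l : Fin m, ∑ i, (Matrix.vandermonde c)⁻¹ j i * c i ^ (l : ℕ) =
        (1 : Matrix (Fin m) (Fin m) k) j l := by
      intro l
      rw [← hW, Matrix.mul_apply]
      simp only [Matrix.vandermonde_apply]
    simp [h1, Matrix.one_apply]
  rw [hv]
  exact sum_mem fun i _ => M.smul_mem _ (h i)

/-! ### The space of shears contained in a group -/

section Closure

variable {n : ℕ} {k : Type*} [Field k] {G : Subgroup (GA (n + 1) k)}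

/-- The space of all `f` for which `(x_1, ..., x_n, x_{n+1} + f)` lies in `G`. -/
def shearSubmodule (G : Subgroup (GA (n + 1) k)) (hG : Aff (n + 1) k ⊆ G) :
    Submodule k (MvPolynomial (Fin n) k) where
  carrier := {f | shear f ∈ G}
  add_mem' {f g} hf hg := by
    rw [Set.mem_ofPred_eq, shear_add]
    exact mul_mem hf hg
  zero_mem' := by
    rw [Set.mem_ofPred_eq, shear_zero]
    exact one_mem G
  smul_mem' c f hf := by
    rw [Set.mem_ofPred_eq]
    -- Conjugation by a scaling of `x_{n+1}` handles only invertible scalars.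
    by_cases hc : c = 0
    · rw [hc, zero_smul, shear_zero]
      exact one_mem G
    · have h := scale_mul_shear (Units.mk0 c hc) f
      have hs : scale (Fin.last n) (Units.mk0 c hc) ∈ G := hG (isAffine_scale _ _)
      rw [Units.val_mk0] at h
      rw [eq_inv_mul_of_mul_eq h]
      exact mul_mem (inv_mem hs) (mul_mem hf hs)

variable {hG : Aff (n + 1) k ⊆ G}

theorem mem_shearSubmodule {f : MvPolynomial (Fin n) k} :
    f ∈ shearSubmodule G hG ↔ shear f ∈ G := Iff.rfl

theorem affineForms_le_shearSubmodule : affineForms n k ≤ shearSubmodule G hG :=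
  fun _ hf => hG (isAffine_shear hf)

theorem apply_mem_shearSubmodule {φ : GA n k} (hφ : extend n k φ ∈ G)
    {f : MvPolynomial (Fin n) k} (hf : f ∈ shearSubmodule G hG) :
    φ f ∈ shearSubmodule G hG := by
  rw [mem_shearSubmodule] at hf ⊢
  rw [← mul_inv_eq_of_eq_mul (extend_mul_shear φ f)]
  exact mul_mem (mul_mem hφ hf) (inv_mem hφ)

theorem affine_apply_mem_shearSubmodule {φ : GA n k} (hφ : IsAffine φ)
    {f : MvPolynomial (Fin n) k} (hf : f ∈ shearSubmodule G hG) :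
    φ f ∈ shearSubmodule G hG :=
  apply_mem_shearSubmodule (hG (isAffine_extend hφ)) hf

theorem extend_eps_mem [NeZero n] (f : supported k {i : Fin n | i ≠ 0})
    (hf : (f : MvPolynomial (Fin n) k) ∈ shearSubmodule G hG) : extend n k (eps f) ∈ G := by
  rw [extend_eps_eq]
  have hs := hG (isAffine_renameEquiv (R := k) (Equiv.swap (Fin.castSucc (0 : Fin n)) (Fin.last n)))
  exact mul_mem (mul_mem hs hf) hs

end Closure

/-! ### Homogeneous components in the first variable -/

section Components

variable {n : ℕ} {k : Type*} [Field k] {G : Subgroup (GA (n + 1 + 1) k)}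
  {hG : Aff (n + 1 + 1) k ⊆ G}

theorem scale_eq_sum (c : kˣ) (f : MvPolynomial (Fin (n + 1)) k) {m : ℕ}
    (hf : (finSuccEquiv k n f).natDegree < m) :
    scale 0 c f = ∑ j : Fin m, (c : k) ^ (j : ℕ) •
      (rename Fin.succ ((finSuccEquiv k n f).coeff j) * X 0 ^ (j : ℕ)) := by
  have h1 : ∀ g : MvPolynomial (Fin n) k, (finSuccEquiv k n).symm (Polynomial.C g) =
      rename Fin.succ g := fun g => by
    rw [AlgEquiv.symm_apply_eq]
    have h : ((finSuccEquiv k n).toAlgHom.comp (rename Fin.succ)) =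
        Polynomial.CAlgHom (R := k) :=
      MvPolynomial.algHom_ext fun i => by
        rw [AlgHom.comp_apply, rename_X]
        exact finSuccEquiv_X_succ
    exact (DFunLike.congr_fun h g).symm
  have h2 : (finSuccEquiv k n).symm Polynomial.X = X 0 := by
    rw [AlgEquiv.symm_apply_eq, finSuccEquiv_X_zero]
  have h3 : ∀ g : MvPolynomial (Fin n) k, scale 0 c (rename Fin.succ g) = rename Fin.succ g := by
    intro g
    have h : (scale 0 c : GA (n + 1) k).toAlgHom.comp (rename Fin.succ) = rename Fin.succ :=
      MvPolynomial.algHom_ext fun i => by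
        rw [AlgHom.comp_apply, rename_X]
        exact (scale_X _ _ _).trans (if_neg (Fin.succ_ne_zero i))
    exact DFunLike.congr_fun h g
  have h4 : scale 0 c (X 0 : MvPolynomial (Fin (n + 1)) k) = C (c : k) * X 0 := by
    rw [scale_X, if_pos rfl]
  conv_lhs => rw [← (finSuccEquiv k n).symm_apply_apply f,
    (finSuccEquiv k n f).as_sum_range' m hf]
  rw [map_sum, map_sum, Finset.sum_range]
  refine Finset.sum_congr rfl fun j _ => ?_
  rw [← Polynomial.C_mul_X_pow_eq_monomial, map_mul, map_mul, map_pow, map_pow, h1, h2, h3, h4,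
    smul_eq_C_mul, mul_pow, map_pow]
  ring

/-- The scalings `x_1 ↦ c_i x_1` are affine and multiply the degree `j` component by `c_i ^ j`. With
`m` distinct units the Vandermonde system can be solved for the components. -/
theorem component_mem {f : MvPolynomial (Fin (n + 1)) k} (hf : f ∈ shearSubmodule G hG) {m : ℕ}
    (hm : (finSuccEquiv k n f).natDegree < m) {c : Fin m → kˣ} (hc : Function.Injective c)
    (j : ℕ) :
    rename Fin.succ ((finSuccEquiv k n f).coeff j) * X 0 ^ j ∈ shearSubmodule G hG := by
  by_cases hj : j < m
  · refine mem_of_sum_pow_smul_mem (shearSubmodule G hG) (c := fun i => (c i : k))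
      (Units.val_injective.comp hc)
      (fun j : Fin m => rename Fin.succ ((finSuccEquiv k n f).coeff j) * X 0 ^ (j : ℕ))
      (fun i => ?_) ⟨j, hj⟩
    rw [← scale_eq_sum _ f hm]
    exact affine_apply_mem_shearSubmodule (isAffine_scale _ _) hf
  · rw [Polynomial.coeff_eq_zero_of_natDegree_lt (hm.trans_le (not_lt.mp hj)), map_zero, zero_mul]
    exact zero_mem _

end Components

/-! ### From one square to the tame subgroup -/

section Quadratic

variable {n : ℕ} {k : Type*} [Field k] {G : Subgroup (GA (n + 1 + 1) k)}
  {hG : Aff (n + 1 + 1) k ⊆ G}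

theorem X_mem_supported_ne_zero {j : Fin (n + 1)} (hj : j ≠ 0) :
    (X j : MvPolynomial (Fin (n + 1)) k) ∈ supported k {i : Fin (n + 1) | i ≠ 0} := by
  simpa using hj

theorem sq_mem_of_sq_mem {i : Fin (n + 1)} (hi : X i ^ 2 ∈ shearSubmodule G hG)
    (j : Fin (n + 1)) : X j ^ 2 ∈ shearSubmodule G hG := by
  have h := affine_apply_mem_shearSubmodule (isAffine_renameEquiv (R := k) (Equiv.swap i j)) hi
  simpa using h

/-- Polarization of the square under `x_1 ↦ x_1 + x_j`. -/
theorem X_zero_mul_X_mem (h2 : (2 : k) ≠ 0) {i : Fin (n + 1)}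
    (hi : X i ^ 2 ∈ shearSubmodule G hG) {j : Fin (n + 1)} (hj : j ≠ 0) :
    X 0 * X j ∈ shearSubmodule G hG := by
  have h0 := sq_mem_of_sq_mem hi 0
  have h := affine_apply_mem_shearSubmodule
    (isAffine_eps ⟨X j, X_mem_supported_ne_zero hj⟩ (X_mem_affineForms j)) h0
  rw [map_pow, eps_X, if_pos rfl] at h
  have h3 := (shearSubmodule G hG).smul_mem (2⁻¹ : k)
    (sub_mem (sub_mem h h0) (sq_mem_of_sq_mem hi j))
  have h4 : (X 0 + X j) ^ 2 - X 0 ^ 2 - X j ^ 2 =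
      (2 : k) • (X 0 * X j : MvPolynomial (Fin (n + 1)) k) := by
    rw [smul_eq_C_mul, map_ofNat]
    ring
  rw [h4, smul_smul, inv_mul_cancel₀ h2, one_smul] at h3
  exact h3

theorem supported_le_shearSubmodule (h2 : (2 : k) ≠ 0) {i : Fin (n + 1)}
    (hi : X i ^ 2 ∈ shearSubmodule G hG) {f : MvPolynomial (Fin (n + 1)) k}
    (hf : f ∈ supported k {i : Fin (n + 1) | i ≠ 0}) : f ∈ shearSubmodule G hG := by
  have key : ∀ j, j ≠ 0 → ∀ g ∈ supported k {i : Fin (n + 1) | i ≠ 0},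
      g ∈ shearSubmodule G hG → g * X j ∈ shearSubmodule G hG := by
    intro j hj g hg hgM
    have hx := X_zero_mul_X_mem h2 hi hj
    -- `ε(g)` sends `x_1 x_j` to `x_1 x_j + g x_j`, so membership of `g` bootstraps to `g x_j`.
    have h := apply_mem_shearSubmodule (extend_eps_mem ⟨g, hg⟩ hgM) hx
    rw [map_mul, eps_X, if_pos rfl, eps_X, if_neg hj, add_mul] at h
    simpa using sub_mem h hx
  obtain ⟨p, rfl⟩ : ∃ p : MvPolynomial {i : Fin (n + 1) | i ≠ 0} k, rename (↑) p = f := by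
    rw [supported_eq_range_rename] at hf
    exact hf
  clear hf
  induction p using MvPolynomial.induction_on with
  | C a =>
    rw [rename_C]
    exact affineForms_le_shearSubmodule (C_mem_affineForms a)
  | add p q hp hq =>
    rw [map_add]
    exact add_mem hp hq
  | mul_X p j hp =>
    rw [map_mul, rename_X]
    refine key _ j.2 _ ?_ hp
    rw [supported_eq_range_rename]
    exact ⟨p, rfl⟩

theorem map_tame_le (h2 : (2 : k) ≠ 0) (hG : Aff (n + 1 + 1) k ⊆ G) {i : Fin (n + 1)}
    (hi : X i ^ 2 ∈ shearSubmodule G hG) :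
    (Tame (n + 1) k).map (extend (n + 1) k) ≤ G := by
  rw [Subgroup.map_le_iff_le_comap, Tame, Subgroup.closure_le]
  rintro φ (hφ | ⟨f, rfl⟩)
  · exact hG (isAffine_extend hφ)
  · exact extend_eps_mem (hG := hG) f (supported_le_shearSubmodule h2 hi f.2)

end Quadratic

/-! ### Calculus of the two leading coefficients -/

section LeadingTerms

variable {A : Type*} [CommRing A]

/-- The two leading terms of `f` are `u X ^ (e + 1)` and `v X ^ e`. -/
def LeadingTerms (f : Polynomial A) (e : ℕ) (u v : A) : Prop :=
  (f - Polynomial.X ^ e * (Polynomial.C u * Polynomial.X + Polynomial.C v)).degree < (e : WithBot ℕ)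

theorem degree_lt_of_eq_add {f g h : Polynomial A} {n : WithBot ℕ} (hf : f = g + h)
    (hg : g.degree < n) (hh : h.degree < n) : f.degree < n :=
  hf ▸ (Polynomial.degree_add_le g h).trans_lt (max_lt hg hh)

theorem LeadingTerms.add {f g : Polynomial A} {e : ℕ} {u v : A} (hf : LeadingTerms f e u v)
    (hg : g.degree < (e : WithBot ℕ)) : LeadingTerms (f + g) e u v :=
  degree_lt_of_eq_add (by ring) hf hg

theorem LeadingTerms.C_mul {f : Polynomial A} {e : ℕ} {u v : A} (hf : LeadingTerms f e u v)
    (c : A) : LeadingTerms (Polynomial.C c * f) e (c * u) (c * v) := by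
  unfold LeadingTerms at *
  have : Polynomial.C c * f - Polynomial.X ^ e *
      (Polynomial.C (c * u) * Polynomial.X + Polynomial.C (c * v)) = Polynomial.C c *
      (f - Polynomial.X ^ e * (Polynomial.C u * Polynomial.X + Polynomial.C v)) := by
    simp only [map_mul]
    ring
  rw [this, ← Polynomial.smul_eq_C_mul]
  exact (Polynomial.degree_smul_le _ _).trans_lt hf

theorem degree_X_pow_mul_linear_le (e : ℕ) (u v : A) :
    (Polynomial.X ^ e * (Polynomial.C u * Polynomial.X + Polynomial.C v)).degree
      ≤ ((e + 1 : ℕ) : WithBot ℕ) := by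
  refine (Polynomial.degree_mul_le _ _).trans ?_
  push_cast
  exact add_le_add (Polynomial.degree_X_pow_le e) Polynomial.degree_linear_le

theorem LeadingTerms.degree_le {f : Polynomial A} {e : ℕ} {u v : A} (hf : LeadingTerms f e u v) :
    f.degree ≤ ((e + 1 : ℕ) : WithBot ℕ) := by
  rw [← sub_add_cancel f (Polynomial.X ^ e * (Polynomial.C u * Polynomial.X + Polynomial.C v))]
  refine (Polynomial.degree_add_le _ _).trans (max_le (hf.le.trans ?_)
    (degree_X_pow_mul_linear_le e u v))
  exact_mod_cast e.le_succ

theorem LeadingTerms.coeff {f : Polynomial A} {e : ℕ} {u v : A} (hf : LeadingTerms f e u v) :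
    f.coeff e = v := by
  have h := Polynomial.coeff_eq_zero_of_degree_lt hf
  rw [Polynomial.coeff_sub, sub_eq_zero] at h
  rw [h, Polynomial.coeff_X_pow_mul']
  simp

theorem LeadingTerms.sq {f : Polynomial A} {e : ℕ} {u v : A} (hf : LeadingTerms f e u v) :
    LeadingTerms (f ^ 2) (2 * e + 1) (u ^ 2) (2 * u * v) := by
  unfold LeadingTerms at *
  set l : Polynomial A := Polynomial.X ^ e * (Polynomial.C u * Polynomial.X + Polynomial.C v)
    with hl
  set r := f - l with hr
  have hle : l.degree ≤ ((e + 1 : ℕ) : WithBot ℕ) := degree_X_pow_mul_linear_le e u v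
  have hfd : f.degree ≤ ((e + 1 : ℕ) : WithBot ℕ) := LeadingTerms.degree_le hf
  -- `f^2 = l^2 + (f + l) r`, and `l^2` differs from the claimed leading part only by `v^2 X^(2e)`.
  refine degree_lt_of_eq_add (g := (f + l) * r)
    (h := Polynomial.C (v ^ 2) * Polynomial.X ^ (2 * e)) ?_ ?_ ?_
  · simp only [hr, hl, map_mul, map_pow, map_ofNat]
    ring
  · refine (Polynomial.degree_mul_le _ _).trans_lt ?_
    by_cases h0 : r = 0
    · rw [h0, Polynomial.degree_zero, WithBot.add_bot]
      exact WithBot.bot_lt_coe _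
    · rw [Polynomial.degree_eq_natDegree h0] at hf ⊢
      have h1 : (f + l).degree ≤ ((e + 1 : ℕ) : WithBot ℕ) :=
        (Polynomial.degree_add_le _ _).trans (max_le hfd hle)
      have h2 : r.natDegree < e := by exact_mod_cast hf
      refine (add_le_add_left h1 _).trans_lt ?_
      norm_cast
      omega
  · refine (Polynomial.degree_C_mul_X_pow_le _ _).trans_lt ?_
    exact_mod_cast Nat.lt_succ_self _

/-- For `e ≥ 1`, the term `s f` has degree at most `e + 1 < 2e + 1`, so it affects neither leading
coefficient of `f^2`. Only the two squarings and the factor `c` count. -/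
theorem LeadingTerms.henon {f g s : Polynomial A} {e : ℕ} {u v : A} (hf : LeadingTerms f e u v)
    (he : 1 ≤ e) (hs : s.degree ≤ 0) (hg : g.degree < ((4 * e + 3 : ℕ) : WithBot ℕ)) (c : A) :
    LeadingTerms (g + Polynomial.C c * (f ^ 2 + s * f) ^ 2) (4 * e + 3) (c * u ^ 4)
      (c * (4 * u ^ 3 * v)) := by
  have h1 : (s * f).degree < ((2 * e + 1 : ℕ) : WithBot ℕ) := by
    refine ((Polynomial.degree_mul_le _ _).trans (add_le_add hs hf.degree_le)).trans_lt ?_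
    rw [zero_add]
    norm_cast
    omega
  have h2 := ((hf.sq.add h1).sq.C_mul c)
  have h3 : 2 * (2 * e + 1) + 1 = 4 * e + 3 := by ring
  rw [h3] at h2
  rw [add_comm]
  convert h2.add hg using 1 <;> ring

end LeadingTerms

/-! ### The Hénon recurrence -/

section Recurrence

variable {k A : Type*} [Field k] [CommRing A] [Algebra k A]

/-- `f` has degree `4 ^ m` with second leading coefficient a nonzero constant times `s`,
and `g` has at most the degree of `f`. -/
def HenonState (s : A) (m : ℕ) (f g : Polynomial A) : Prop :=
  (∃ u t : k, u ≠ 0 ∧ t ≠ 0 ∧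
    LeadingTerms f (4 ^ m - 1) (algebraMap k A u) (algebraMap k A t * s)) ∧
  g.degree ≤ ((4 ^ m : ℕ) : WithBot ℕ)

theorem HenonState.step (h2 : (2 : k) ≠ 0) {s : A} {m : ℕ} (hm : 1 ≤ m) {f g : Polynomial A}
    (h : HenonState (k := k) s m f g) (c d : k) (hc : c ≠ 0) :
    HenonState (k := k) s (m + 1)
      (g + Polynomial.C (algebraMap k A c) *
        (f ^ 2 + Polynomial.C (algebraMap k A d * s) * f) ^ 2)
      (f + Polynomial.C (algebraMap k A d * s)) := by
  obtain ⟨⟨u, t, hu, ht, hf⟩, hg⟩ := h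
  have hpow : 4 ≤ 4 ^ m := le_self_pow₀ (by norm_num) (by omega)
  have hm' : 4 ^ (m + 1) - 1 = 4 * (4 ^ m - 1) + 3 := by rw [pow_succ]; omega
  refine ⟨⟨c * u ^ 4, c * (4 * u ^ 3 * t), mul_ne_zero hc (pow_ne_zero _ hu), ?_, ?_⟩, ?_⟩
  · have h4 : (4 : k) ≠ 0 := by
      rw [show (4 : k) = 2 * 2 by norm_num]
      exact mul_ne_zero h2 h2
    exact mul_ne_zero hc (mul_ne_zero (mul_ne_zero h4 (pow_ne_zero _ hu)) ht)
  · have := hf.henon (by omega) (Polynomial.degree_C_le (a := algebraMap k A d * s))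
      (g := g) (hg.trans_lt (by norm_cast; omega)) (algebraMap k A c)
    rw [hm']
    convert this using 1
    · simp
    · simp only [map_mul, map_pow, map_ofNat]
      ring
  · refine (Polynomial.degree_add_le _ _).trans (max_le (hf.degree_le.trans ?_)
      (Polynomial.degree_C_le.trans ?_))
    · norm_cast
      rw [pow_succ]
      omega
    · exact_mod_cast Nat.zero_le _

/-- This is where `s` enters: `-(X^2 - sX)^2` begins `-X^4 + 2sX^3`. Starting from `X` itself would
mean `e = 0`, which the generic step excludes because there `s f` does reach the second coefficient.
-/
theorem HenonState.initial (h2 : (2 : k) ≠ 0) (s x : A) :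
    HenonState (k := k) s 1
      (Polynomial.C x - (Polynomial.X ^ 2 - Polynomial.C s * Polynomial.X) ^ 2)
      (Polynomial.X - Polynomial.C s) := by
  refine ⟨⟨-1, 2, by simp, h2, ?_⟩, ?_⟩
  · have h1 : LeadingTerms (Polynomial.X ^ 2 - Polynomial.C s * Polynomial.X) 1 1 (-s) := by
      unfold LeadingTerms
      have : Polynomial.X ^ 2 - Polynomial.C s * Polynomial.X - Polynomial.X ^ 1 *
          (Polynomial.C 1 * Polynomial.X + Polynomial.C (-s)) = 0 := by
        simp only [map_neg, map_one]
        ring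
      rw [this, Polynomial.degree_zero]
      exact WithBot.bot_lt_coe _
    have h3 := (h1.sq.C_mul (-1)).add (g := Polynomial.C x)
      (Polynomial.degree_C_le.trans_lt (by norm_num))
    norm_num at h3 ⊢
    convert h3 using 1
    · ring
    · rw [map_ofNat]
  · refine (Polynomial.degree_sub_le _ _).trans (max_le (Polynomial.degree_X_le.trans ?_)
      (Polynomial.degree_C_le.trans ?_))
    · norm_num
    · norm_num

end Recurrence

/-! ### Degree and second coefficient of `θ_N(x_1)` -/

section Theta

variable (k : Type*) [Field k]

theorem beta_mul_pi_X_zero : (beta k * pi k) (X 0) = X 1 + X 2 ^ 2 := by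
  simp [AlgEquiv.mul_apply, beta, pi]

theorem beta_mul_pi_X_one :
    (beta k * pi k) (X 1) = X 0 + X 1 ^ 2 * (X 1 + X 2 ^ 2) ^ 2 := by
  simp [AlgEquiv.mul_apply, beta, pi]

theorem beta_mul_pi_X_two : (beta k * pi k) (X 2) = X 2 := by
  simp [AlgEquiv.mul_apply, beta, pi]

theorem beta_mul_pi_inv_X_one : (beta k * pi k)⁻¹ (X 1) = X 0 - X 2 ^ 2 := by
  change (beta k * pi k).symm (X 1) = _
  rw [AlgEquiv.symm_apply_eq, map_sub, map_pow, beta_mul_pi_X_zero, beta_mul_pi_X_two]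
  ring

theorem beta_mul_pi_inv_X_two : (beta k * pi k)⁻¹ (X 2) = X 2 := by
  change (beta k * pi k).symm (X 2) = _
  rw [AlgEquiv.symm_apply_eq, beta_mul_pi_X_two]

theorem beta_mul_pi_inv_X_zero :
    (beta k * pi k)⁻¹ (X 0) = X 1 - (X 0 ^ 2 - X 2 ^ 2 * X 0) ^ 2 := by
  change (beta k * pi k).symm (X 0) = _
  rw [AlgEquiv.symm_apply_eq]
  simp only [map_sub, map_pow, map_mul, beta_mul_pi_X_zero, beta_mul_pi_X_one, beta_mul_pi_X_two]
  ring

theorem pi_X_zero : pi k (X 0) = X 1 := by simp [pi]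

theorem pi_X_one : pi k (X 1) = X 0 := by simp [pi]

theorem pi_X_two : pi k (X 2) = X 2 := by simp [pi]

theorem pow_X_two {φ : GA 3 k} (h : φ (X 2) = X 2) (m : ℕ) : (φ ^ m) (X 2) = X 2 := by
  induction m with
  | zero => rfl
  | succ m ih => rw [pow_succ, AlgEquiv.mul_apply, h, ih]

theorem finSuccEquiv_two_X_one : finSuccEquiv k 2 (X 1) = Polynomial.C (X 0) :=
  finSuccEquiv_X_succ (j := 0)

theorem finSuccEquiv_two_X_two : finSuccEquiv k 2 (X 2) = Polynomial.C (X 1) :=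
  finSuccEquiv_X_succ (j := 1)

variable {k}

theorem henonState_inv_pow (h2 : (2 : k) ≠ 0) (m : ℕ) :
    HenonState (k := k) (X 1 ^ 2) (m + 1)
      (finSuccEquiv k 2 (((beta k * pi k)⁻¹ ^ (m + 1)) (X 0)))
      (finSuccEquiv k 2 (((beta k * pi k)⁻¹ ^ (m + 1)) (X 1))) := by
  induction m with
  | zero =>
    have h := HenonState.initial h2 (X 1 ^ 2 : MvPolynomial (Fin 2) k) (X 0)
    simp only [zero_add, pow_one, beta_mul_pi_inv_X_zero, beta_mul_pi_inv_X_one, map_sub, map_pow,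
      map_mul, finSuccEquiv_X_zero, finSuccEquiv_two_X_one, finSuccEquiv_two_X_two]
    simpa only [map_pow] using h
  | succ m ih =>
    have h := ih.step h2 (by omega) (-1) (-1) (by simp)
    have h3 := pow_X_two k (beta_mul_pi_inv_X_two k) (m + 1)
    rw [pow_succ (beta k * pi k)⁻¹, AlgEquiv.mul_apply, AlgEquiv.mul_apply, beta_mul_pi_inv_X_zero,
      beta_mul_pi_inv_X_one]
    simp only [map_sub, map_pow, map_mul, h3, finSuccEquiv_two_X_two]
    simp only [map_neg, map_one, map_mul, map_pow] at h
    convert h using 1 <;> ring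

/-- The factor `π` exchanges the roles of `x_1` and `x_2`. The forward powers of `β ∘ π` therefore
do not cancel the inverse powers but continue the same recurrence, with opposite signs. -/
theorem henonState_conj (h2 : (2 : k) ≠ 0) (N m : ℕ) :
    HenonState (k := k) (X 1 ^ 2) (N + 1 + m)
      (finSuccEquiv k 2
        (((beta k * pi k)⁻¹ ^ (N + 1) * pi k * (beta k * pi k) ^ m) (X 1)))
      (finSuccEquiv k 2
        (((beta k * pi k)⁻¹ ^ (N + 1) * pi k * (beta k * pi k) ^ m) (X 0))) := by
  induction m with
  | zero =>
    rw [pow_zero, mul_one, AlgEquiv.mul_apply, AlgEquiv.mul_apply, pi_X_zero, pi_X_one]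
    exact henonState_inv_pow h2 N
  | succ m ih =>
    have h := ih.step h2 (by omega) 1 1 one_ne_zero
    have h3 : ((beta k * pi k)⁻¹ ^ (N + 1) * pi k * (beta k * pi k) ^ m) (X 2) = X 2 := by
      rw [AlgEquiv.mul_apply, AlgEquiv.mul_apply, pow_X_two k (beta_mul_pi_X_two k), pi_X_two,
        pow_X_two k (beta_mul_pi_inv_X_two k)]
    rw [pow_succ (beta k * pi k), ← mul_assoc, AlgEquiv.mul_apply _ (beta k * pi k),
      AlgEquiv.mul_apply _ (beta k * pi k), beta_mul_pi_X_zero, beta_mul_pi_X_one]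
    simp only [map_add, map_pow, map_mul, h3, finSuccEquiv_two_X_two]
    simp only [map_one, map_mul, map_pow] at h
    convert h using 1 <;> ring

/-- As polynomials in `x_1`, the degree of `θ_N(x_1)` is at most `4 ^ (2 N - 1)`, and the second
coefficient is a nonzero multiple of `x_3 ^ 2`. -/
theorem theta_X_zero (h2 : (2 : k) ≠ 0) {N : ℕ} (hN : 1 ≤ N) :
    (finSuccEquiv k 2 (theta k N (X 0))).natDegree ≤ 4 ^ (2 * N - 1) ∧
    ∃ t : k, t ≠ 0 ∧
      (finSuccEquiv k 2 (theta k N (X 0))).coeff (4 ^ (2 * N - 1) - 1) = C t * X 1 ^ 2 := by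
  obtain ⟨N, rfl⟩ := Nat.exists_eq_add_of_le' hN
  obtain ⟨⟨u, t, -, ht, hf⟩, -⟩ := henonState_conj h2 N N
  have h3 : ((beta k * pi k)⁻¹ ^ (N + 1) * pi k * (beta k * pi k) ^ N) (X 2) = X 2 := by
    rw [AlgEquiv.mul_apply, AlgEquiv.mul_apply, pow_X_two k (beta_mul_pi_X_two k), pi_X_two,
      pow_X_two k (beta_mul_pi_inv_X_two k)]
  have hθ : finSuccEquiv k 2 (theta k (N + 1) (X 0)) = finSuccEquiv k 2
      (((beta k * pi k)⁻¹ ^ (N + 1) * pi k * (beta k * pi k) ^ N) (X 1)) +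
      Polynomial.C (X 1 ^ 2) := by
    -- The last forward factor sends `x_1` only to `x_2 + x_3^2`, with no increase in degree. This
    -- explains the exponent `2N - 1`, one less than `2N`.
    rw [theta, zpow_neg, zpow_natCast, ← inv_pow, pow_succ (beta k * pi k) N, ← mul_assoc,
      AlgEquiv.mul_apply, beta_mul_pi_X_zero, map_add, map_pow, h3, map_add, map_pow,
      finSuccEquiv_two_X_two, map_pow]
  have he : 2 * (N + 1) - 1 = N + 1 + N := by omega
  have hpow : 4 ≤ 4 ^ (N + 1 + N) := le_self_pow₀ (by norm_num) (by omega)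
  have hf' := hf.add (g := Polynomial.C (X 1 ^ 2)) (Polynomial.degree_C_le.trans_lt
    (by norm_cast; omega))
  rw [← hθ] at hf'
  rw [he]
  refine ⟨?_, t, ht, hf'.coeff⟩
  have := Polynomial.natDegree_le_of_degree_le hf'.degree_le
  omega

end Theta

/-! ### Extraction of `x_3^2` and conclusion -/

theorem exists_injective_units {k : Type*} [Field k] {m : ℕ}
    (h : ((m + 1 : ℕ) : Cardinal) ≤ Cardinal.mk k) :
    ∃ c : Fin m → kˣ, Function.Injective c := by
  classical
  obtain ⟨S, hS⟩ := Cardinal.exists_finset_eq_card h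
  have hS' : m ≤ (S.erase 0).card := by
    have := Finset.pred_card_le_card_erase (s := S) (a := 0)
    omega
  let e := (S.erase 0).equivFin.symm
  refine ⟨fun i => Units.mk0 (e (Fin.castLE hS' i)) (Finset.ne_of_mem_erase (e _).2),
    fun i j hij => ?_⟩
  have h1 := congrArg Units.val hij
  simpa [Subtype.val_inj] using h1

theorem X_two_sq_mem {k : Type*} [Field k] (h2 : (2 : k) ≠ 0) {N : ℕ} (hN : 1 ≤ N)
    (hk : ((4 ^ (2 * N - 1) + 2 : ℕ) : Cardinal) ≤ Cardinal.mk k) {G : Subgroup (GA 4 k)}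
    (hG : Aff 4 k ⊆ G) (hθ : extend 3 k (theta k N) ∈ G) :
    (X 2 ^ 2 : MvPolynomial (Fin 3) k) ∈ shearSubmodule G hG := by
  -- A polynomial of degree at most `4 ^ (2N - 1)` has one more coefficient slot than this bound.
  -- Excluding the scalar 0 accounts for the second unit in `+ 2`.
  obtain ⟨c, hc⟩ := exists_injective_units (m := 4 ^ (2 * N - 1) + 1) hk
  obtain ⟨hdeg, t, ht, hcoeff⟩ := theta_X_zero h2 hN
  set d := 4 ^ (2 * N - 1) - 1
  have hmem : theta k N (X 0) ∈ shearSubmodule G hG :=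
    apply_mem_shearSubmodule hθ (affineForms_le_shearSubmodule (X_mem_affineForms 0))
  have h1 := component_mem hmem (Nat.lt_succ_of_le hdeg) hc d
  rw [hcoeff, map_mul, rename_C, map_pow, rename_X, mul_assoc, ← smul_eq_C_mul] at h1
  have h3 := (shearSubmodule G hG).smul_mem t⁻¹ h1
  rw [smul_smul, inv_mul_cancel₀ ht, one_smul] at h3
  -- The translation `x_1 ↦ x_1 + 1` turns `x_3^2 x_1^d` into `x_3^2 (x_1 + 1)^d`, whose component
  -- of degree 0 in `x_1` is `x_3^2`.
  have hone : (1 : MvPolynomial (Fin 3) k) ∈ supported k {i : Fin 3 | i ≠ 0} := one_mem _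
  have h4 := affine_apply_mem_shearSubmodule (isAffine_eps ⟨1, hone⟩
    (by simpa using C_mem_affineForms (n := 3) (1 : k))) h3
  rw [map_mul, map_pow, map_pow, eps_X, if_neg (by decide), eps_X, if_pos rfl] at h4
  have hF : finSuccEquiv k 2 (X (Fin.succ 1) ^ 2 * (X 0 + 1) ^ d) =
      Polynomial.C (X 1 ^ 2) * (Polynomial.X + Polynomial.C 1) ^ d := by
    rw [map_mul, map_pow, map_pow, map_add, map_one, finSuccEquiv_X_succ, finSuccEquiv_X_zero,
      map_one, map_pow]
  have hdeg' : (finSuccEquiv k 2 (X (Fin.succ 1) ^ 2 * (X 0 + 1) ^ d)).natDegree <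
      4 ^ (2 * N - 1) + 1 := by
    rw [hF]
    refine Nat.lt_succ_of_le ((Polynomial.natDegree_C_mul_le _ _).trans ?_)
    rw [Polynomial.natDegree_pow_X_add_C]
    exact Nat.sub_le _ _
  have h5 := component_mem h4 hdeg' hc 0
  rw [hF, Polynomial.coeff_zero_eq_eval_zero] at h5
  simpa using h5

end PolyAut

end

theorem theorem6p1 {k : Type*} [Field k] (p : ℕ) [CharP k p] (hp : 3 ≤ p)
    (N : ℕ) (hN : 1 ≤ N) (hk : ((4 ^ (2 * N - 1) + 2 : ℕ) : Cardinal) ≤ Cardinal.mk k) :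
    PolyAut.IsStablyCoTame (PolyAut.theta k N) := by
  have h2 : (2 : k) ≠ 0 := fun h => by
    have := Nat.le_of_dvd two_pos ((CharP.cast_eq_zero_iff k p 2).mp (by exact_mod_cast h))
    omega
  have hG : PolyAut.Aff 4 k ⊆ Subgroup.closure
      (PolyAut.Aff 4 k ∪ {PolyAut.extend 3 k (PolyAut.theta k N)}) :=
    fun _ h => Subgroup.subset_closure (Or.inl h)
  exact PolyAut.map_tame_le h2 hG
    (PolyAut.X_two_sq_mem h2 hN hk hG (Subgroup.subset_closure (Or.inr rfl)))
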